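/- Let $\mathbb T=\mathbb R/\mathbb Z$ and $\underline{\mathbb R}=\mathbb R\cup\{-\infty\}$. Let $n\ge 1$ be an integer and let $\nu_1,\dots,\nu_n>0$. Let $K:(-1,0)\cup(0,1)\to\mathbb R$ be a singular periodic kernel function, i.e. $K$ is concave on $(-1,0)$ and on $(0,1)$ (not necessarily strictly), $K(t-1)=K(t)$ for $t\in(0,1)$, and $\lim_{t\downarrow 0}K(t)=\lim_{t\uparrow 0}K(t)=-\infty$. Extend $K$ to a function $\mathbb T\to\underline{\mathbb R}$ by periodicity and $K(0):=-\infty$. Let $J:\mathbb T\to\underline{\mathbb R}$ be an $n$-field function, i.e. $J$ is bounded above and $J(t)>-\infty$ for more than $n$ points $t\in\mathbb T$ ($J$ is otherwise arbitrary). For $\mathbf y=(y_1,\dots,y_n)\in\mathbb T^n$ and $t\in\mathbb T$ put $$F(\mathbf y,t):=J(t)+\sum_{j=1}^n\nu_jK(t-y_j).$$ Let $\overline L\subset\mathbb T^n$ be the set of those $\mathbf y$ whose coordinates have representatives $x_j\in\mathbb R$ with $x_1\le x_2\le\dots\le x_n\le x_1+1$, and let $L\subset\overline L$ be the set of those $\mathbf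 y$ that have representatives with $x_1<x_2<\dots<x_n<x_1+1$. For $\mathbf y\in\overline L$ and $1\le j\le n$ (with $y_{n+1}:=y_1$) let $I_j^*(\mathbf y)\subset\mathbb T$ be the closed arc from $y_j$ to $y_{j+1}$ in the positive direction, which is $\{y_j\}$ if $y_j=y_{j+1}$; except that $I_n^*(\mathbf y):=\mathbb T$ if $y_1=\dots=y_n$ (in particular if $n=1$). Put $$m_j^*(\mathbf y):=\sup_{t\in I_j^*(\mathbf y)}F(\mathbf y,t),\qquad \underline m^*(\mathbf y):=\min_{1\le j\le n}m_j^*(\mathbf y),\qquad m^*(\overline L):=\sup_{\mathbf y\in\overline L}\underline m^*(\mathbf y).$$ Then there exists a maximin point $\mathbf z^*\in\overline L$, i.e. $\underline m^*(\mathbf z^*)=m^*(\overline L)$, such that $\mathbf z^*\in L$ and $\mathbf z^*$ is an equioscillation point, i.e. $m_1^*(\mathbf z^*)=m_2^*(\mathbf z^*)=\dots=m_n^*(\mathbf z^*)$. -/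

import Mathlib

open Set Filter Topology

noncomputable section

namespace SumOfTranslates

/-- The torus `ℝ / ℤ`. -/
abbrev Torus : Type := AddCircle (1 : ℝ)

/-- The representative in `[0, 1)` of a point of the torus. -/
def rep (t : Torus) : ℝ := (AddCircle.equivIco (1 : ℝ) 0 t : ℝ)

/-! ### Kernel functions

A kernel function is a real function on `(-1, 0) ∪ (0, 1)`; it is represented here by a
function `K : ℝ → ℝ` of which only the values on `(-1, 0) ∪ (0, 1)` are ever used. -/

/-- `K` is concave on `(-1, 0)` and on `(0, 1)`, and its two one-sided limits at `0`
(in the extended reals) coincide. -/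
structure IsKernelFunction (K : ℝ → ℝ) : Prop where
  concaveOn_left : ConcaveOn ℝ (Ioo (-1) 0) K
  concaveOn_right : ConcaveOn ℝ (Ioo 0 1) K
  limit_zero : ∃ l : EReal,
    Tendsto (fun t : ℝ => (K t : EReal)) (𝓝[>] 0) (𝓝 l) ∧
    Tendsto (fun t : ℝ => (K t : EReal)) (𝓝[<] 0) (𝓝 l)

/-- The value `K(0) := lim_{t ↓ 0} K(t)`, an extended real number. -/
def kernelZero (K : ℝ → ℝ) : EReal :=
  limUnder (𝓝[>] (0 : ℝ)) (fun t : ℝ => (K t : EReal))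

/-- The kernel is singular: `K(0) = -∞`. -/
def IsSingularKernel (K : ℝ → ℝ) : Prop := kernelZero K = ⊥

/-- The kernel is periodic: `K(t - 1) = K(t)`. For a kernel function, the corresponding
identities for the limits at `-1`, `0`, `1` follow from this one. -/
def IsPeriodicKernel (K : ℝ → ℝ) : Prop := ∀ t ∈ Ioo (0 : ℝ) 1, K (t - 1) = K t

open Classical in
/-- The extended-valued function on the torus given by a periodic kernel function `K`:
the limit value `K(0)` at `0`, and `K` elsewhere. -/
def kernelOnTorus (K : ℝ → ℝ) (t : Torus) : EReal :=
  if t = 0 then kernelZero K else (K (rep t) : EReal)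

/-! ### Field functions and sums of translates -/

/-- `J` is an (external) `n`-field function on the torus: it takes values in `ℝ ∪ {-∞}`, is
bounded above, and is finite at more than `n` points. -/
structure IsFieldFunction (n : ℕ) (J : Torus → EReal) : Prop where
  bddAbove : ∃ C : ℝ, ∀ t, J t ≤ (C : EReal)
  finite_points : (n : ℕ∞) < {t | J t ≠ ⊥}.encard

/-- `F(y, t) = J(t) + ∑ⱼ νⱼ K(t - yⱼ)`. -/
def sumOfTranslates {n : ℕ} (ν : Fin n → ℝ) (K : ℝ → ℝ) (J : Torus → EReal)
    (y : Fin n → Torus) (t : Torus) : EReal :=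
  J t + ∑ j, (ν j : EReal) * kernelOnTorus K (t - y j)

/-! ### Cyclically ordered node systems and their arcs -/

/-- The open cyclic simplex `L`: starting from `y₁` and moving once around the torus in the
positive direction one meets `y₁, y₂, …, yₙ` in this order, and they are distinct. -/
def cyclicSimplex (n : ℕ) : Set (Fin n → Torus) :=
  {y | ∃ x : Fin n → ℝ, (∀ j, (x j : Torus) = y j) ∧ StrictMono x ∧ ∀ i j, x j < x i + 1}

/-- The closed cyclic simplex: as for `cyclicSimplex`, but nodes may coincide. -/
def closedCyclicSimplex (n : ℕ) : Set (Fin n → Torus) :=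
  {y | ∃ x : Fin n → ℝ, (∀ j, (x j : Torus) = y j) ∧ Monotone x ∧ ∀ i j, x j ≤ x i + 1}

/-- The closed arc described when moving from `a` in the positive direction until `b` is
reached for the first time; in particular `arc a a = {a}`. -/
def arc (a b : Torus) : Set Torus := {t | rep (t - a) ≤ rep (b - a)}

open Classical in
/-- The arc between the `j`-th node and the cyclically next one (`j + 1` is taken modulo `n`).
If all nodes coincide (in particular if `n = 1`), then the last arc is the whole torus, and the
others are degenerate. -/
def nodeArc {n : ℕ} [NeZero n] (y : Fin n → Torus) (j : Fin n) : Set Torus :=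
  if (j : ℕ) + 1 = n ∧ ∀ i, y i = y j then univ else arc (y j) (y (j + 1))

/-- The arc maximum (in fact supremum) `m*ⱼ(y)`. -/
def arcMax {n : ℕ} [NeZero n] (ν : Fin n → ℝ) (K : ℝ → ℝ) (J : Torus → EReal)
    (y : Fin n → Torus) (j : Fin n) : EReal :=
  ⨆ t ∈ nodeArc y j, sumOfTranslates ν K J y t

/-- The smallest arc maximum: `min_j m*ⱼ(y)`. -/
def minArcMax {n : ℕ} [NeZero n] (ν : Fin n → ℝ) (K : ℝ → ℝ) (J : Torus → EReal)
    (y : Fin n → Torus) : EReal :=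
  ⨅ j, arcMax ν K J y j

/-- The maximin value: the supremum of `min_j m*ⱼ(y)` over the closed cyclic simplex. -/
def maximinValue {n : ℕ} [NeZero n] (ν : Fin n → ℝ) (K : ℝ → ℝ) (J : Torus → EReal) : EReal :=
  ⨆ y ∈ closedCyclicSimplex n, minArcMax ν K J y

/-- `z` is a maximin point on the closed cyclic simplex. -/
def IsMaximinPoint {n : ℕ} [NeZero n] (ν : Fin n → ℝ) (K : ℝ → ℝ) (J : Torus → EReal)
    (z : Fin n → Torus) : Prop :=
  z ∈ closedCyclicSimplex n ∧ minArcMax ν K J z = maximinValue ν K J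

/-- `z` is an equioscillation point: all arc maxima are equal. -/
def IsEquioscillationPoint {n : ℕ} [NeZero n] (ν : Fin n → ℝ) (K : ℝ → ℝ) (J : Torus → EReal)
    (z : Fin n → Torus) : Prop :=
  ∀ i j, arcMax ν K J z i = arcMax ν K J z j

end SumOfTranslates

end

/-! Exponentiation turns `F` into `W(t) ∏ a(t - yⱼ)^νⱼ`, where `a = exp K` is continuous on the
torus with `a 0 = 0`, and `W = exp J` is bounded. The product vanishes at every node, so the arc
suprema depend continuously on the nodes although `J` is arbitrary (`continuous_arcSup`). Node
systems modulo integer shifts are compact, hence maximizers of the smallest arc supremum exist.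

Suppose that at a maximizer some arc supremum exceeds the smallest one. Push the two endpoints of
that arc slightly towards each other, keeping their weighted mean. By concavity of the kernel the
product does not decrease on the complementary arc, and every other arc only gets larger. If the
kernel is strictly concave, all the other suprema grow strictly, while the shrunk arc stays above
the minimum by continuity, which contradicts maximality.

As `K` need not be strictly concave, `ε s (1 - s)` is added to it. The gain is then an explicit
factor `exp (ε h · length)` (`IsExpKernel.translateProd_shrink`), and maximizers equioscillate
(`IsExpKernel.arcSup_eq_of_maximizer`). The tilt changes the arc suprema by at most a factor `exp (ε
∑ νᵢ)`, uniformly in the nodes, so a limit point as `ε → 0` is an equioscillating maximizer for `K`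
itself. Its value is positive because the field is finite at enough points
(`IsFieldFunction.exists_minArcSup_pos`), whereas a degenerate arc has supremum zero; so the nodes
are distinct. -/

noncomputable section

namespace SumOfTranslates

variable {n : ℕ}

/-! ### Products of translates and their arc suprema -/

/-- The lift of the cyclically next node. -/
def next {n : ℕ} [NeZero n] (x : Fin n → ℝ) (j : Fin n) : ℝ :=
  x (j + 1) + if (j : ℕ) + 1 = n then 1 else 0

/-- `∏ᵢ a(s - xᵢ) ^ νᵢ`. -/
def translateProd {n : ℕ} (a : Torus → ℝ) (ν : Fin n → ℝ) (x : Fin n → ℝ) (s : ℝ) : ℝ :=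
  ∏ i, a ((s - x i : ℝ) : Torus) ^ ν i

/-- Projection of `s` to the interval `[x j, next x j]`. -/
def clamp {n : ℕ} [NeZero n] (x : Fin n → ℝ) (j : Fin n) (s : ℝ) : ℝ :=
  max (x j) (min s (next x j))

/-- The supremum of `W(s) ∏ᵢ a(s - xᵢ) ^ νᵢ` over the `j`-th arc, written as a supremum over the
real line. -/
def arcSup {n : ℕ} [NeZero n] (a : Torus → ℝ) (ν : Fin n → ℝ) (W : Torus → ℝ)
    (x : Fin n → ℝ) (j : Fin n) : ℝ :=
  ⨆ s : ℝ, W s * translateProd a ν x (clamp x j s)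

lemma coe_next [NeZero n] (x : Fin n → ℝ) (j : Fin n) :
    ((next x j : ℝ) : Torus) = x (j + 1) := by
  unfold next
  split_ifs
  · rw [AddCircle.coe_add, AddCircle.coe_period, add_zero]
  · rw [add_zero]

lemma translateProd_nonneg {a : Torus → ℝ} (ha : ∀ t, 0 ≤ a t) (ν x : Fin n → ℝ) (s : ℝ) :
    0 ≤ translateProd a ν x s :=
  Finset.prod_nonneg fun _ _ => Real.rpow_nonneg (ha _) _

lemma translateProd_eq_zero {a : Torus → ℝ} (ha0 : a 0 = 0) {ν x : Fin n → ℝ} {s : ℝ} {i : Fin n}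
    (hν : 0 < ν i) (h : (s : Torus) = x i) : translateProd a ν x s = 0 := by
  refine Finset.prod_eq_zero (Finset.mem_univ i) ?_
  rw [AddCircle.coe_sub, h, sub_self, ha0, Real.zero_rpow hν.ne']

lemma exists_translateProd_le {a : Torus → ℝ} (hc : Continuous a) {ν : Fin n → ℝ}
    (hν : ∀ j, 0 < ν j) : ∃ D, ∀ x s, translateProd a ν x s ≤ D := by
  have hQ : Continuous fun r : (Fin n → Torus) × Torus => ∏ i, a (r.2 - r.1 i) ^ ν i :=
    continuous_finsetProd _ fun i _ => (by fun_prop : Continuous fun r :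
      (Fin n → Torus) × Torus => a (r.2 - r.1 i)).rpow_const fun _ => Or.inr (hν i).le
  obtain ⟨D, hD⟩ := (isCompact_range hQ).bddAbove
  exact ⟨D, fun x s => by simpa [translateProd] using hD ⟨(fun i => (x i : Torus), (s : Torus)), rfl⟩⟩

lemma uniformContinuous_coe_torus : UniformContinuous fun s : ℝ => (s : Torus) := by
  let f : ℝ →+ Torus :=
    { toFun := fun s => (s : Torus), map_zero' := rfl, map_add' := fun _ _ => rfl }
  exact uniformContinuous_addMonoidHom_of_continuous (f := f) (AddCircle.continuous_mk' 1)

/-- The product factors through a compact power of the torus, where continuity is already uniform.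
-/
lemma uniformContinuous_translateProd {a : Torus → ℝ} (hc : Continuous a) {ν : Fin n → ℝ}
    (hν : ∀ j, 0 < ν j) :
    UniformContinuous fun r : (Fin n → ℝ) × ℝ => translateProd a ν r.1 r.2 := by
  have hQ : Continuous fun r : (Fin n → Torus) × Torus => ∏ i, a (r.2 - r.1 i) ^ ν i :=
    continuous_finsetProd _ fun i _ => (by fun_prop : Continuous fun r :
      (Fin n → Torus) × Torus => a (r.2 - r.1 i)).rpow_const fun _ => Or.inr (hν i).le
  have h1 : UniformContinuous fun r : (Fin n → ℝ) × ℝ => fun i => (r.1 i : Torus) :=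
    uniformContinuous_pi.2 fun i => uniformContinuous_coe_torus.comp
      ((Pi.uniformContinuous_proj (fun _ : Fin n => ℝ) i).comp uniformContinuous_fst)
  have h2 : UniformContinuous fun r : (Fin n → ℝ) × ℝ => (r.2 : Torus) :=
    uniformContinuous_coe_torus.comp uniformContinuous_snd
  have h3 := (CompactSpace.uniformContinuous_of_continuous hQ).comp (h1.prodMk h2)
  exact h3.congr fun _ => rfl

lemma abs_clamp_sub_clamp_le [NeZero n] (x y : Fin n → ℝ) (j : Fin n) (s : ℝ) :
    |clamp x j s - clamp y j s| ≤ dist x y := by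
  have h1 : |x j - y j| ≤ dist x y := dist_le_pi_dist x y j
  have h2 : |x (j + 1) - y (j + 1)| ≤ dist x y := dist_le_pi_dist x y (j + 1)
  refine (abs_max_sub_max_le_max _ _ _ _).trans (max_le h1 ?_)
  refine (abs_min_sub_min_le_max _ _ _ _).trans (max_le (by simp [dist_nonneg]) ?_)
  simpa [next] using h2

lemma uniformContinuous_translateProd_clamp [NeZero n] {a : Torus → ℝ} (hc : Continuous a)
    {ν : Fin n → ℝ} (hν : ∀ j, 0 < ν j) (j : Fin n) {ε : ℝ} (hε : 0 < ε) :
    ∃ δ > 0, ∀ x y : Fin n → ℝ, dist x y < δ → ∀ s,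
      |translateProd a ν x (clamp x j s) - translateProd a ν y (clamp y j s)| < ε := by
  obtain ⟨δ, hδ, h⟩ := Metric.uniformContinuous_iff.1 (uniformContinuous_translateProd hc hν) ε hε
  refine ⟨δ, hδ, fun x y hxy s => h (a := (x, clamp x j s)) (b := (y, clamp y j s)) ?_⟩
  rw [Prod.dist_eq]
  exact max_lt hxy ((abs_clamp_sub_clamp_le x y j s).trans_lt hxy)

section

variable [NeZero n] {a : Torus → ℝ} {ν : Fin n → ℝ} {W : Torus → ℝ} {C : ℝ}

lemma bddAbove_arcSup (hc : Continuous a) (ha : ∀ t, 0 ≤ a t) (hν : ∀ j, 0 < ν j)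
    (hW : ∀ t, 0 ≤ W t) (hWC : ∀ t, W t ≤ C) (x : Fin n → ℝ) (j : Fin n) :
    BddAbove (range fun s : ℝ => W s * translateProd a ν x (clamp x j s)) := by
  obtain ⟨D, hD⟩ := exists_translateProd_le hc hν
  refine ⟨C * D, ?_⟩
  rintro _ ⟨s, rfl⟩
  exact mul_le_mul (hWC _) (hD _ _) (translateProd_nonneg ha _ _ _) ((hW s).trans (hWC _))

lemma clamp_of_mem {x : Fin n → ℝ} {j : Fin n} {s : ℝ} (hs : s ∈ Icc (x j) (next x j)) :
    clamp x j s = s := by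
  rw [clamp, min_eq_left hs.2, max_eq_right hs.1]

lemma le_arcSup (hc : Continuous a) (ha : ∀ t, 0 ≤ a t) (hν : ∀ j, 0 < ν j)
    (hW : ∀ t, 0 ≤ W t) (hWC : ∀ t, W t ≤ C) {x : Fin n → ℝ} {j : Fin n} {s : ℝ}
    (hs : s ∈ Icc (x j) (next x j)) : W s * translateProd a ν x s ≤ arcSup a ν W x j := by
  have h := le_ciSup (bddAbove_arcSup hc ha hν hW hWC x j) s
  simp only [clamp_of_mem hs] at h
  exact h

lemma arcSup_nonneg (ha : ∀ t, 0 ≤ a t) (hW : ∀ t, 0 ≤ W t) (x : Fin n → ℝ) (j : Fin n) :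
    0 ≤ arcSup a ν W x j :=
  Real.iSup_nonneg fun _ => mul_nonneg (hW _) (translateProd_nonneg ha _ _ _)

/-- Outside the arc, `clamp` returns an endpoint, which is a node. Hence the supremum over all of
`ℝ` in `arcSup` only sees the arc, while its index set does not depend on the nodes. -/
lemma translateProd_clamp_of_notMem (ha0 : a 0 = 0) (hν : ∀ j, 0 < ν j) {x : Fin n → ℝ} {j : Fin n}
    {s : ℝ} (hs : s ∉ Ioo (x j) (next x j)) : translateProd a ν x (clamp x j s) = 0 := by
  have key : clamp x j s = x j ∨ clamp x j s = next x j := by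
    unfold clamp
    rcases le_or_gt s (x j) with h | h
    · left
      exact max_eq_left ((min_le_left _ _).trans h)
    · have h' : next x j ≤ s := not_lt.1 fun h2 => hs ⟨h, h2⟩
      rw [min_eq_right h']
      exact max_choice _ _
  rcases key with h | h
  · exact translateProd_eq_zero ha0 (hν j) (by rw [h])
  · exact translateProd_eq_zero ha0 (hν (j + 1)) (by rw [h, coe_next])

lemma arcSup_le (ha0 : a 0 = 0) (hν : ∀ j, 0 < ν j) {x : Fin n → ℝ} {j : Fin n} {c : ℝ}
    (hc : 0 ≤ c) (h : ∀ s ∈ Ioo (x j) (next x j), W s * translateProd a ν x s ≤ c) :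
    arcSup a ν W x j ≤ c := by
  refine ciSup_le fun s => ?_
  by_cases hs : s ∈ Ioo (x j) (next x j)
  · rw [clamp_of_mem (Ioo_subset_Icc_self hs)]
    exact h s hs
  · rw [translateProd_clamp_of_notMem ha0 hν hs, mul_zero]
    exact hc

lemma lt_next_of_arcSup_pos (ha0 : a 0 = 0) (hν : ∀ j, 0 < ν j) {x : Fin n → ℝ} {j : Fin n}
    (h : 0 < arcSup a ν W x j) : x j < next x j := by
  by_contra hx
  refine h.not_ge (arcSup_le ha0 hν le_rfl fun s hs => absurd (hs.1.trans hs.2) hx)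

/-- For fixed `s` the factor `W s` is the same for all node systems, and only the clamped product
varies, uniformly in `s`. So no regularity of `W` beyond boundedness is needed. -/
lemma continuous_arcSup (hc : Continuous a) (ha : ∀ t, 0 ≤ a t) (hν : ∀ j, 0 < ν j)
    (hW : ∀ t, 0 ≤ W t) (hWC : ∀ t, W t ≤ C) (j : Fin n) :
    Continuous fun x => arcSup a ν W x j := by
  have hC : 0 ≤ C := (hW 0).trans (hWC 0)
  rw [Metric.continuous_iff]
  intro y ε hε
  obtain ⟨δ, hδ, h⟩ := uniformContinuous_translateProd_clamp hc hν j
    (ε := ε / (2 * (C + 1))) (by positivity)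
  have key : ∀ x z : Fin n → ℝ, dist x z < δ →
      arcSup a ν W x j ≤ arcSup a ν W z j + ε / 2 := by
    intro x z hxz
    refine ciSup_le fun s => ?_
    have h1 := le_ciSup (bddAbove_arcSup hc ha hν hW hWC z j) s
    have h2 := (abs_lt.1 (h x z hxz s)).2
    have h3 : W s * (translateProd a ν x (clamp x j s) - translateProd a ν z (clamp z j s))
        ≤ (C + 1) * (ε / (2 * (C + 1))) := by
      refine (mul_le_mul_of_nonneg_left h2.le (hW s)).trans ?_
      exact mul_le_mul_of_nonneg_right ((hWC s).trans (by linarith)) (by positivity)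
    have h4 : (C + 1) * (ε / (2 * (C + 1))) = ε / 2 := by field_simp
    change _ ≤ arcSup a ν W z j at h1
    linarith [mul_sub (W s) (translateProd a ν x (clamp x j s)) (translateProd a ν z (clamp z j s))]
  refine ⟨δ, hδ, fun x hx => ?_⟩
  rw [Real.dist_eq, abs_lt]
  have h1 := key x y hx
  have h2 := key y x (by rwa [dist_comm])
  constructor <;> linarith

lemma arcSup_add_intCast (x : Fin n → ℝ) (m : ℤ) (j : Fin n) :
    arcSup a ν W (fun i => x i + m) j = arcSup a ν W x j := by
  unfold arcSup
  rw [← (Equiv.addRight (m : ℝ)).iSup_comp]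
  refine iSup_congr fun s => ?_
  have hm : ((m : ℝ) : Torus) = 0 := by
    rw [AddCircle.coe_eq_zero_iff]
    exact ⟨m, by simp⟩
  have hcl : clamp (fun i => x i + m) j (s + m) = clamp x j s + m := by
    have hn : next (fun i => x i + (m : ℝ)) j = next x j + m := by
      unfold next; ring
    unfold clamp
    rw [hn, min_add_add_right, max_add_add_right]
  simp only [Equiv.coe_addRight, hcl, translateProd, AddCircle.coe_add, hm, add_zero]
  congr 1
  refine Finset.prod_congr rfl fun i _ => ?_
  rw [add_sub_add_right_eq_sub]

end

/-! ### Lifted node systems -/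

lemma monotone_of_le_next [NeZero n] {x : Fin n → ℝ} (h : ∀ j, x j ≤ next x j) :
    Monotone x ∧ ∀ i j, x j ≤ x i + 1 := by
  obtain ⟨m, rfl⟩ := Nat.exists_eq_succ_of_ne_zero (NeZero.ne n)
  have hmono : Monotone x := by
    refine Fin.monotone_iff_le_succ.2 fun i => ?_
    have hi := h i.castSucc
    have h1 : ¬ ((i : ℕ) = m) := i.2.ne
    simpa [next, h1] using hi
  refine ⟨hmono, fun i j => ?_⟩
  have hl := h (Fin.last m)
  simp only [next, Fin.last_add_one, Fin.val_last, if_true] at hl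
  exact (hmono (Fin.le_last j)).trans (hl.trans (by gcongr; exact hmono (Fin.zero_le i)))

lemma strictMono_of_lt_next [NeZero n] {x : Fin n → ℝ} (h : ∀ j, x j < next x j) :
    StrictMono x ∧ ∀ i j, x j < x i + 1 := by
  obtain ⟨m, rfl⟩ := Nat.exists_eq_succ_of_ne_zero (NeZero.ne n)
  have hmono : StrictMono x := by
    refine Fin.strictMono_iff_lt_succ.2 fun i => ?_
    have hi := h i.castSucc
    have h1 : ¬ ((i : ℕ) = m) := i.2.ne
    simpa [next, h1] using hi
  refine ⟨hmono, fun i j => ?_⟩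
  have hl := h (Fin.last m)
  simp only [next, Fin.last_add_one, Fin.val_last, if_true] at hl
  exact (hmono.monotone (Fin.le_last j)).trans_lt
    (hl.trans_le (by gcongr; exact hmono.monotone (Fin.zero_le i)))

lemma le_next_of_monotone [NeZero n] {x : Fin n → ℝ} (h : Monotone x)
    (h1 : ∀ i j, x j ≤ x i + 1) (j : Fin n) : x j ≤ next x j := by
  unfold next
  split_ifs with hj
  · exact h1 _ _
  · rw [add_zero]
    refine h ?_
    rw [Fin.le_def, Fin.val_add_one_of_lt' (by omega)]
    omega

lemma add_one_eq_zero [NeZero n] {j : Fin n} (hj : (j : ℕ) + 1 = n) : j + 1 = 0 := by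
  ext
  simp [Fin.val_add, hj]

lemma next_le_add_one [NeZero n] {x : Fin n → ℝ} (h : ∀ j, x j ≤ next x j) (i j : Fin n) :
    next x j ≤ x i + 1 := by
  unfold next
  split_ifs with hj
  · rw [add_one_eq_zero hj]
    gcongr
    exact (monotone_of_le_next h).1 (Fin.zero_le i)
  · rw [add_zero]
    exact (monotone_of_le_next h).2 _ _

/-- Up to an integer shift, each arc other than the `j`-th lies in the complement of the `j`-th. -/
lemma mem_complement_arc [NeZero n] {x : Fin n → ℝ} (h : ∀ j, x j ≤ next x j) {i j : Fin n}
    (hij : i ≠ j) {s : ℝ} (hs : s ∈ Icc (x i) (next x i)) :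
    s ∈ Icc (next x j) (x j + 1) ∨ s + 1 ∈ Icc (next x j) (x j + 1) := by
  have hm := (monotone_of_le_next h).1
  rcases lt_or_gt_of_ne hij with hlt | hlt
  · right
    have hi : (i : ℕ) + 1 ≠ n := by have := j.2; rw [Fin.lt_def] at hlt; omega
    have hle : i + 1 ≤ j := by
      rw [Fin.le_def, Fin.val_add_one_of_lt' (by omega)]
      exact hlt
    have h2 : next x i ≤ x j := by
      rw [next, if_neg hi, add_zero]
      exact hm hle
    have h3 := next_le_add_one h i j
    exact ⟨by linarith [hs.1], by linarith [hs.2]⟩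
  · left
    have hj : (j : ℕ) + 1 ≠ n := by have := i.2; rw [Fin.lt_def] at hlt; omega
    have hle : j + 1 ≤ i := by
      rw [Fin.le_def, Fin.val_add_one_of_lt' (by omega)]
      exact hlt
    have h2 : next x j ≤ x i := by
      rw [next, if_neg hj, add_zero]
      exact hm hle
    have h3 := next_le_add_one h j i
    exact ⟨by linarith [hs.1], by linarith [hs.2]⟩

/-! ### Exponentials of kernels -/

/-- A function on the torus which is the exponential of a singular periodic kernel. -/
structure IsExpKernel (a : Torus → ℝ) : Prop where
  continuous : Continuous a
  zero : a 0 = 0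
  pos : ∀ s ∈ Ioo (0 : ℝ) 1, 0 < a (s : Torus)
  concaveOn_log : ConcaveOn ℝ (Ioo 0 1) fun s : ℝ => Real.log (a (s : Torus))

/-- The strictly concave bounded function `s (1 - s)`, periodically continued. -/
def bump : Torus → ℝ := AddCircle.liftIco 1 0 fun s : ℝ => s * (1 - s)

lemma bump_coe {s : ℝ} (hs : s ∈ Ico (0 : ℝ) 1) : bump s = s * (1 - s) :=
  AddCircle.liftIco_zero_coe_apply hs

lemma continuous_bump : Continuous bump :=
  AddCircle.liftIco_continuous (by simp) (by fun_prop)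

lemma exists_coe_eq (t : Torus) : ∃ s ∈ Ico (0 : ℝ) 1, (s : Torus) = t :=
  ⟨AddCircle.equivIco 1 0 t, by simpa using (AddCircle.equivIco (1 : ℝ) 0 t).2,
    AddCircle.coe_equivIco⟩

lemma bump_mem_Icc (t : Torus) : bump t ∈ Icc (0 : ℝ) 1 := by
  obtain ⟨s, hs, rfl⟩ := exists_coe_eq t
  rw [bump_coe hs]
  constructor <;> nlinarith [hs.1, hs.2]

/-- The kernel `a` multiplied by `exp (ε * bump)`. -/
def tilt (a : Torus → ℝ) (ε : ℝ) (t : Torus) : ℝ := a t * Real.exp (ε * bump t)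

lemma IsExpKernel.pos_of_ne_zero {a : Torus → ℝ} (ha : IsExpKernel a) {t : Torus} (ht : t ≠ 0) :
    0 < a t := by
  obtain ⟨s, hs, rfl⟩ := exists_coe_eq t
  refine ha.pos s ⟨hs.1.lt_of_ne fun h => ht ?_, hs.2⟩
  rw [← h]; rfl

lemma IsExpKernel.nonneg {a : Torus → ℝ} (ha : IsExpKernel a) (t : Torus) : 0 ≤ a t := by
  by_cases ht : t = 0
  · rw [ht, ha.zero]
  · exact (ha.pos_of_ne_zero ht).le

lemma IsExpKernel.continuous_tilt {a : Torus → ℝ} (ha : IsExpKernel a) (ε : ℝ) :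
    Continuous (tilt a ε) :=
  ha.continuous.mul (Real.continuous_exp.comp (continuous_bump.const_mul ε))

lemma IsExpKernel.tilt_zero {a : Torus → ℝ} (ha : IsExpKernel a) (ε : ℝ) : tilt a ε 0 = 0 := by
  rw [tilt, ha.zero, zero_mul]

lemma IsExpKernel.tilt_nonneg {a : Torus → ℝ} (ha : IsExpKernel a) (ε : ℝ) (t : Torus) :
    0 ≤ tilt a ε t :=
  mul_nonneg (ha.nonneg t) (Real.exp_pos _).le

lemma le_tilt {a : Torus → ℝ} (ha : ∀ t, 0 ≤ a t) {ε : ℝ} (hε : 0 ≤ ε) (t : Torus) :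
    a t ≤ tilt a ε t :=
  le_mul_of_one_le_right (ha t) (Real.one_le_exp (mul_nonneg hε (bump_mem_Icc t).1))

lemma tilt_le {a : Torus → ℝ} (ha : ∀ t, 0 ≤ a t) {ε : ℝ} (hε : 0 ≤ ε) (t : Torus) :
    tilt a ε t ≤ a t * Real.exp ε :=
  mul_le_mul_of_nonneg_left
    (Real.exp_le_exp.2 (mul_le_of_le_one_right hε (bump_mem_Icc t).2)) (ha t)

/-- The move preserves `q u + p v`, so chord bounds show that the `k`-part does not decrease. The
quadratic part gains exactly `ε h (2 (v - u) - (h / p + h / q))`, which is at least `ε h (v - u)` by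
`hle`. -/
lemma concave_add_quadratic_ineq {k : ℝ → ℝ} {S : Set ℝ} (hk : ConcaveOn ℝ S k) {u v p q h ε : ℝ}
    (hu : u ∈ S) (hv : v ∈ S) (huv : u < v) (hp : 0 < p) (hq : 0 < q) (hh : 0 ≤ h) (hε : 0 ≤ ε)
    (hle : h / p + h / q ≤ v - u) :
    q * (k u + ε * (u * (1 - u))) + p * (k v + ε * (v * (1 - v))) + ε * (h * (v - u)) ≤
      q * (k (u + h / q) + ε * ((u + h / q) * (1 - (u + h / q)))) +
      p * (k (v - h / p) + ε * ((v - h / p) * (1 - (v - h / p)))) := by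
  have hd : 0 < v - u := sub_pos.2 huv
  have hp' : 0 ≤ h / p := by positivity
  have hq' : 0 ≤ h / q := by positivity
  have step : ∀ lam : ℝ, 0 ≤ lam → lam ≤ v - u →
      (v - u - lam) / (v - u) * k u + lam / (v - u) * k v ≤ k (u + lam) := by
    intro lam h0 h1
    have := hk.2 hu hv 
      (show 0 ≤ (v - u - lam) / (v - u) from div_nonneg (by linarith) hd.le)
      (show 0 ≤ lam / (v - u) from div_nonneg h0 hd.le) (by field_simp; ring)
    simp only [smul_eq_mul] at this
    have e : (v - u - lam) / (v - u) * u + lam / (v - u) * v = u + lam := by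
      field_simp
      ring
    rwa [e] at this
  have s1 := step (h / q) hq' (by linarith)
  have s2 := step (v - h / p - u) (by linarith) (by linarith)
  have e2 : u + (v - h / p - u) = v - h / p := by ring
  rw [e2] at s2
  have s3 := mul_le_mul_of_nonneg_left s1 hq.le
  have s4 := mul_le_mul_of_nonneg_left s2 hp.le
  have e1 : q * ((v - u - h / q) / (v - u) * k u + h / q / (v - u) * k v) +
      p * ((v - u - (v - h / p - u)) / (v - u) * k u + (v - h / p - u) / (v - u) * k v) =
      q * k u + p * k v := by
    field_simp
    ring
  have e3 : q * ((u + h / q) * (1 - (u + h / q))) + p * ((v - h / p) * (1 - (v - h / p))) =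
      q * (u * (1 - u)) + p * (v * (1 - v)) + h * (2 * (v - u) - (h / p + h / q)) := by
    field_simp
    ring
  have e4 : ε * (h * (v - u)) ≤ ε * (h * (2 * (v - u) - (h / p + h / q))) :=
    mul_le_mul_of_nonneg_left (mul_le_mul_of_nonneg_left (by linarith) hh) hε
  linear_combination s3 + s4 + e4 - e1 - ε * e3

lemma IsExpKernel.tilt_mul_tilt_le {a : Torus → ℝ} (ha : IsExpKernel a) {u v p q h ε : ℝ}
    (hu : 0 < u) (hv : v < 1) (huv : u < v) (hp : 0 < p) (hq : 0 < q) (hh : 0 ≤ h) (hε : 0 ≤ ε)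
    (hle : h / p + h / q ≤ v - u) :
    tilt a ε (u : ℝ) ^ q * tilt a ε (v : ℝ) ^ p * Real.exp (ε * (h * (v - u))) ≤
      tilt a ε ((u + h / q : ℝ) : Torus) ^ q * tilt a ε ((v - h / p : ℝ) : Torus) ^ p := by
  have hp' : 0 ≤ h / p := by positivity
  have hq' : 0 ≤ h / q := by positivity
  have key : ∀ s ∈ Ioo (0 : ℝ) 1, ∀ r : ℝ, tilt a ε (s : ℝ) ^ r =
      Real.exp (r * (Real.log (a (s : ℝ)) + ε * (s * (1 - s)))) := by
    intro s hs r
    have h0 := ha.pos s hs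
    rw [tilt, bump_coe (Ioo_subset_Ico_self hs), mul_comm r, Real.exp_mul _ r, Real.exp_add,
      Real.exp_log h0]
  rw [key u ⟨hu, by linarith⟩, key v ⟨by linarith, hv⟩, key (u + h / q) ⟨by linarith, by linarith⟩,
    key (v - h / p) ⟨by linarith, by linarith⟩, ← Real.exp_add, ← Real.exp_add, ← Real.exp_add]
  exact Real.exp_le_exp.2 (concave_add_quadratic_ineq ha.concaveOn_log ⟨hu, by linarith⟩
    ⟨by linarith, hv⟩ huv hp hq hh hε hle)

/-! ### Shrinking one arc -/

/-- Move the endpoints of the `j`-th arc towards each other, keeping the weighted mean. -/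
def shrink [NeZero n] (ν x : Fin n → ℝ) (j : Fin n) (h : ℝ) (i : Fin n) : ℝ :=
  x i + (if i = j then h / ν j else 0) - (if i = j + 1 then h / ν (j + 1) else 0)

section

variable [NeZero n] {ν x : Fin n → ℝ} {j : Fin n} {h : ℝ}

lemma shrink_self (hj : j + 1 ≠ j) : shrink ν x j h j = x j + h / ν j := by
  simp [shrink, hj.symm]

lemma next_shrink_self (hj : j + 1 ≠ j) :
    next (shrink ν x j h) j = next x j - h / ν (j + 1) := by
  simp only [next, shrink, hj, if_true, if_false]
  ring

lemma shrink_le (hν : ∀ j, 0 < ν j) (hh : 0 ≤ h) {i : Fin n} (hi : i ≠ j) :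
    shrink ν x j h i ≤ x i := by
  have : 0 ≤ h / ν (j + 1) := div_nonneg hh (hν _).le
  simp only [shrink, hi, if_false]
  split_ifs <;> linarith

/-- Together with `shrink_le`: every arc other than the `j`-th is contained in its new version. -/
lemma next_le_next_shrink (hν : ∀ j, 0 < ν j) (hh : 0 ≤ h) {i : Fin n} (hi : i ≠ j) :
    next x i ≤ next (shrink ν x j h) i := by
  have : 0 ≤ h / ν j := div_nonneg hh (hν _).le
  simp only [next, shrink, add_left_inj, hi, if_false]
  split_ifs <;> linarith

lemma continuous_shrink : Continuous (shrink ν x j) := by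
  refine continuous_pi fun i => ?_
  unfold shrink
  split_ifs <;> fun_prop

lemma shrink_zero : shrink ν x j 0 = x := by
  ext i
  simp [shrink]

/-- Seen from `s` in the complementary arc, the two moved nodes are at distances `u = s - next x j`
and `v = s - x j` in `[0, 1]`, and shrinking the arc brings `u` and `v` closer. The other factors do
not change. If `u = 0` or `v = 1`, the left side is zero. -/
lemma IsExpKernel.translateProd_shrink {a : Torus → ℝ} (ha : IsExpKernel a) (hν : ∀ j, 0 < ν j)
    (hj : j + 1 ≠ j) {ε s : ℝ} (hlt : x j < next x j) (hs : s ∈ Icc (next x j) (x j + 1))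
    (hh : 0 ≤ h) (hε : 0 ≤ ε) (hle : h / ν j + h / ν (j + 1) ≤ next x j - x j) :
    translateProd (tilt a ε) ν x s * Real.exp (ε * (h * (next x j - x j))) ≤
      translateProd (tilt a ε) ν (shrink ν x j h) s := by
  have hnn := translateProd_nonneg (ha.tilt_nonneg ε) ν (shrink ν x j h) s
  rcases hs.1.eq_or_lt with h0 | h0
  · rw [translateProd_eq_zero (ha.tilt_zero ε) (hν (j + 1)) (by rw [← h0, coe_next]), zero_mul]
    exact hnn
  rcases hs.2.eq_or_lt with h1 | h1
  · rw [translateProd_eq_zero (ha.tilt_zero ε) (hν j) (by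
      rw [h1, AddCircle.coe_add, AddCircle.coe_period, add_zero]), zero_mul]
    exact hnn
  have hu : ∀ d : ℝ, ((s - (x (j + 1) - d) : ℝ) : Torus) = ((s - next x j + d : ℝ) : Torus) := by
    intro d
    simp only [AddCircle.coe_add, AddCircle.coe_sub, coe_next]
    abel
  have split : ∀ y : Fin n → ℝ, translateProd (tilt a ε) ν y s =
      tilt a ε ((s - y (j + 1) : ℝ) : Torus) ^ ν (j + 1) *
      tilt a ε ((s - y j : ℝ) : Torus) ^ ν j *
      ∏ i ∈ (Finset.univ.erase (j + 1)).erase j, tilt a ε ((s - y i : ℝ) : Torus) ^ ν i := by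
    intro y
    rw [translateProd, ← Finset.mul_prod_erase _ _ (Finset.mem_univ (j + 1)),
      ← Finset.mul_prod_erase _ _ (Finset.mem_erase.2 ⟨hj.symm, Finset.mem_univ j⟩), mul_assoc]
  have hrest : ∏ i ∈ (Finset.univ.erase (j + 1)).erase j,
      tilt a ε ((s - shrink ν x j h i : ℝ) : Torus) ^ ν i =
      ∏ i ∈ (Finset.univ.erase (j + 1)).erase j, tilt a ε ((s - x i : ℝ) : Torus) ^ ν i := by
    refine Finset.prod_congr rfl fun i hi => ?_
    simp only [Finset.mem_erase] at hi
    simp [shrink, hi.1, hi.2.1]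
  have hj1 : shrink ν x j h (j + 1) = x (j + 1) - h / ν (j + 1) := by simp [shrink, hj]
  have hj0 : s - (x j + h / ν j) = s - x j - h / ν j := by ring
  have hu0 := hu 0
  simp only [sub_zero, add_zero] at hu0
  rw [split, split (shrink ν x j h), hrest, hj1, shrink_self hj, hu, hu0, hj0, mul_right_comm]
  refine mul_le_mul_of_nonneg_right ?_
    (Finset.prod_nonneg fun i _ => Real.rpow_nonneg (ha.tilt_nonneg ε _) _)
  have := ha.tilt_mul_tilt_le (u := s - next x j) (v := s - x j) (p := ν j) (q := ν (j + 1))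
    (h := h) (ε := ε) (by linarith) (by linarith) (by linarith) (hν _) (hν _) hh hε (by linarith)
  rwa [show s - x j - (s - next x j) = next x j - x j by ring] at this

end

/-! ### Maximizers -/

/-- The smallest arc supremum. -/
def minArcSup [NeZero n] (a : Torus → ℝ) (ν : Fin n → ℝ) (W : Torus → ℝ) (x : Fin n → ℝ) : ℝ :=
  Finset.univ.inf' Finset.univ_nonempty (arcSup a ν W x)

/-- Lifts of closed node systems whose first node lies in `[0, 1]`. -/
def liftedSimplex (n : ℕ) [NeZero n] : Set (Fin n → ℝ) :=
  {x | (∀ j, x j ≤ next x j) ∧ x 0 ∈ Icc (0 : ℝ) 1}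

lemma isCompact_liftedSimplex [NeZero n] : IsCompact (liftedSimplex n) := by
  refine (isCompact_Icc (a := fun _ : Fin n => (0 : ℝ)) (b := fun _ => 2)).of_isClosed_subset ?_ ?_
  · refine IsClosed.inter (?_ : IsClosed {x : Fin n → ℝ | ∀ j, x j ≤ next x j})
      (isClosed_Icc.preimage (continuous_apply 0))
    rw [ofPred_forall]
    refine isClosed_iInter fun j => ?_
    exact isClosed_le (continuous_apply j) ((continuous_apply _).add continuous_const)
  · rintro x ⟨hx, h0, h1⟩
    obtain ⟨hm, hle⟩ := monotone_of_le_next hx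
    exact ⟨fun j => h0.trans (hm (Fin.zero_le j)), fun j => (hle 0 j).trans (by linarith)⟩

lemma exists_maximizer [NeZero n] {m : (Fin n → ℝ) → ℝ} (hm : Continuous m)
    (hshift : ∀ x (k : ℤ), m (fun i => x i + k) = m x) :
    ∃ z ∈ liftedSimplex n, ∀ x, (∀ j, x j ≤ next x j) → m x ≤ m z := by
  have hne : (liftedSimplex n).Nonempty :=
    ⟨fun _ => 0, fun j => by simp only [next]; split_ifs <;> norm_num, by simp⟩
  obtain ⟨z, hz, hmax⟩ := isCompact_liftedSimplex.exists_isMaxOn hne hm.continuousOn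
  refine ⟨z, hz, fun x hx => ?_⟩
  rw [← hshift x (-⌊x 0⌋)]
  refine hmax ⟨fun j => ?_, ?_⟩
  · have := hx j
    simp only [next] at this ⊢
    linarith
  · push_cast
    exact ⟨by linarith [Int.floor_le (x 0)], by linarith [Int.lt_floor_add_one (x 0)]⟩

section

variable [NeZero n] {a : Torus → ℝ} {ν : Fin n → ℝ} {W : Torus → ℝ} {C : ℝ}

lemma exists_minArcSup_maximizer (hc : Continuous a) (ha : ∀ t, 0 ≤ a t) (hν : ∀ j, 0 < ν j)
    (hW : ∀ t, 0 ≤ W t) (hWC : ∀ t, W t ≤ C) :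
    ∃ z ∈ liftedSimplex n, ∀ x, (∀ j, x j ≤ next x j) →
      minArcSup a ν W x ≤ minArcSup a ν W z := by
  refine exists_maximizer (m := minArcSup a ν W) ?_ fun x k => ?_
  · exact Continuous.finset_inf'_apply _ fun j _ => continuous_arcSup hc ha hν hW hWC j
  · unfold minArcSup
    congr 1
    ext j
    exact arcSup_add_intCast x k j

/-- For the tilted kernel, maximizers equioscillate. -/
lemma IsExpKernel.arcSup_eq_of_maximizer (ha : IsExpKernel a) (hν : ∀ j, 0 < ν j)
    (hW : ∀ t, 0 ≤ W t) (hWC : ∀ t, W t ≤ C) {ε : ℝ} (hε : 0 < ε) {z : Fin n → ℝ}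
    (hz : ∀ j, z j ≤ next z j)
    (hmax : ∀ x, (∀ j, x j ≤ next x j) →
      minArcSup (tilt a ε) ν W x ≤ minArcSup (tilt a ε) ν W z)
    (hpos : 0 < minArcSup (tilt a ε) ν W z) (j : Fin n) :
    arcSup (tilt a ε) ν W z j = minArcSup (tilt a ε) ν W z := by
  set v := minArcSup (tilt a ε) ν W z with hv
  have hc := ha.continuous_tilt ε
  have hnn := ha.tilt_nonneg ε
  have hge : ∀ i, v ≤ arcSup (tilt a ε) ν W z i := fun i => Finset.inf'_le _ (Finset.mem_univ i)
  by_contra hne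
  have hvj : v < arcSup (tilt a ε) ν W z j := lt_of_le_of_ne (hge j) (Ne.symm hne)
  obtain ⟨i₀, -, hi₀⟩ := Finset.exists_mem_eq_inf' Finset.univ_nonempty (arcSup (tilt a ε) ν W z)
  -- With a single node there is a single arc, which attains the minimum, so there is nothing to
  -- move.
  have hj : j + 1 ≠ j := by
    intro h
    have h1 : (1 : Fin n) = 0 := by simpa using h
    have hn : n = 1 := Fin.one_eq_zero_iff.1 h1
    subst hn
    rw [Subsingleton.elim j i₀] at hne
    exact hne hi₀.symm
  have hlt : z j < next z j := lt_next_of_arcSup_pos (ha.tilt_zero ε) hν (hpos.trans hvj)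
  have hcont : Continuous fun h : ℝ => arcSup (tilt a ε) ν W (shrink ν z j h) j :=
    (continuous_arcSup hc hnn hν hW hWC j).comp continuous_shrink
  have ev1 : ∀ᶠ h in 𝓝 (0 : ℝ), v < arcSup (tilt a ε) ν W (shrink ν z j h) j :=
    hcont.continuousAt.eventually_const_lt (by simpa only [shrink_zero] using hvj)
  have ev2 : ∀ᶠ h in 𝓝 (0 : ℝ), h / ν j + h / ν (j + 1) < next z j - z j := by
    have : Continuous fun h : ℝ => h / ν j + h / ν (j + 1) := by fun_prop
    exact this.continuousAt.eventually_lt_const (by simpa using hlt)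
  obtain ⟨h, ⟨h1, h2⟩, hh⟩ :=
    (((ev1.and ev2).filter_mono nhdsWithin_le_nhds).and self_mem_nhdsWithin :
      ∀ᶠ h in 𝓝[>] (0 : ℝ), _).exists
  have hh' : (0 : ℝ) < h := hh
  set c := Real.exp (ε * (h * (next z j - z j))) with hcdef
  have hc1 : 1 < c := Real.one_lt_exp_iff.2 (mul_pos hε (mul_pos hh' (sub_pos.2 hlt)))
  have hx : ∀ i, shrink ν z j h i ≤ next (shrink ν z j h) i := by
    intro i
    by_cases hi : i = j
    · rw [hi, shrink_self hj, next_shrink_self hj]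
      linarith
    · exact (shrink_le hν hh'.le hi).trans ((hz i).trans (next_le_next_shrink hν hh'.le hi))
  -- Maximality is contradicted once every arc supremum of the shrunk system exceeds `v`: the `j`-th
  -- by continuity, the others through the factor `c > 1`, which is a strict gain since `v > 0`.
  refine (hmax _ hx).not_gt ((Finset.lt_inf'_iff _).2 fun i _ => ?_)
  by_cases hi : i = j
  · rwa [hi]
  have hgrow : arcSup (tilt a ε) ν W z i ≤ arcSup (tilt a ε) ν W (shrink ν z j h) i / c := by
    refine arcSup_le (ha.tilt_zero ε) hν
      (div_nonneg (arcSup_nonneg hnn hW _ _) (Real.exp_pos _).le) fun s hs => ?_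
    have hs := Ioo_subset_Icc_self hs
    rw [le_div_iff₀ (Real.exp_pos _), mul_assoc]
    refine le_trans (mul_le_mul_of_nonneg_left ?_ (hW _)) (le_arcSup hc hnn hν hW hWC
      ⟨(shrink_le hν hh'.le hi).trans hs.1, hs.2.trans (next_le_next_shrink hν hh'.le hi)⟩)
    rcases mem_complement_arc hz hi hs with h3 | h3
    · exact ha.translateProd_shrink hν hj hlt h3 hh'.le hε.le h2.le
    · have per : ∀ y : Fin n → ℝ, translateProd (tilt a ε) ν y (s + 1) =
          translateProd (tilt a ε) ν y s := fun y => Finset.prod_congr rfl fun i _ => by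
        rw [add_sub_right_comm, AddCircle.coe_add, AddCircle.coe_period, add_zero]
      have := ha.translateProd_shrink hν hj hlt h3 hh'.le hε.le h2.le
      rwa [per, per] at this
  rw [le_div_iff₀ (Real.exp_pos _)] at hgrow
  have := hge i
  nlinarith

/-! ### Removing the tilt -/

omit [NeZero n] in
lemma translateProd_le_tilt (ha : ∀ t, 0 ≤ a t) (hν : ∀ j, 0 < ν j) {ε : ℝ} (hε : 0 ≤ ε)
    (x : Fin n → ℝ) (s : ℝ) : translateProd a ν x s ≤ translateProd (tilt a ε) ν x s :=
  Finset.prod_le_prod (fun _ _ => Real.rpow_nonneg (ha _) _) fun i _ =>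
    Real.rpow_le_rpow (ha _) (le_tilt ha hε _) (hν i).le

omit [NeZero n] in
lemma translateProd_tilt_le (ha : ∀ t, 0 ≤ a t) (hν : ∀ j, 0 < ν j) {ε : ℝ} (hε : 0 ≤ ε)
    (x : Fin n → ℝ) (s : ℝ) :
    translateProd (tilt a ε) ν x s ≤ translateProd a ν x s * Real.exp (ε * ∑ i, ν i) := by
  rw [Finset.mul_sum, Real.exp_sum, translateProd, translateProd, ← Finset.prod_mul_distrib]
  have h0 : ∀ t, 0 ≤ tilt a ε t := fun t => mul_nonneg (ha t) (Real.exp_pos _).le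
  refine Finset.prod_le_prod (fun _ _ => Real.rpow_nonneg (h0 _) _) fun i _ => ?_
  rw [Real.exp_mul, ← Real.mul_rpow (ha _) (Real.exp_pos _).le]
  exact Real.rpow_le_rpow (h0 _) (tilt_le ha hε _) (hν i).le

lemma IsExpKernel.arcSup_le_tilt (ha : IsExpKernel a) (hν : ∀ j, 0 < ν j)
    (hW : ∀ t, 0 ≤ W t) (hWC : ∀ t, W t ≤ C) {ε : ℝ} (hε : 0 ≤ ε) (x : Fin n → ℝ) (j : Fin n) :
    arcSup a ν W x j ≤ arcSup (tilt a ε) ν W x j :=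
  arcSup_le ha.zero hν (arcSup_nonneg (ha.tilt_nonneg ε) hW _ _) fun _ hs =>
    (mul_le_mul_of_nonneg_left (translateProd_le_tilt ha.nonneg hν hε _ _) (hW _)).trans
      (le_arcSup (ha.continuous_tilt ε) (ha.tilt_nonneg ε) hν hW hWC (Ioo_subset_Icc_self hs))

lemma IsExpKernel.arcSup_tilt_le (ha : IsExpKernel a) (hν : ∀ j, 0 < ν j)
    (hW : ∀ t, 0 ≤ W t) (hWC : ∀ t, W t ≤ C) {ε : ℝ} (hε : 0 ≤ ε) (x : Fin n → ℝ) (j : Fin n) :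
    arcSup (tilt a ε) ν W x j ≤ arcSup a ν W x j * Real.exp (ε * ∑ i, ν i) := by
  refine arcSup_le (ha.tilt_zero ε) hν
    (mul_nonneg (arcSup_nonneg ha.nonneg hW _ _) (Real.exp_pos _).le) fun s hs => ?_
  refine (mul_le_mul_of_nonneg_left (translateProd_tilt_le ha.nonneg hν hε _ _) (hW _)).trans ?_
  rw [← mul_assoc]
  exact mul_le_mul_of_nonneg_right
    (le_arcSup ha.continuous ha.nonneg hν hW hWC (Ioo_subset_Icc_self hs)) (Real.exp_pos _).le

/-- There is an equioscillating maximizer of the smallest arc supremum. -/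
theorem IsExpKernel.exists_equioscillating_maximizer (ha : IsExpKernel a) (hν : ∀ j, 0 < ν j)
    (hW : ∀ t, 0 ≤ W t) (hWC : ∀ t, W t ≤ C)
    (hpos : ∃ x : Fin n → ℝ, (∀ j, x j ≤ next x j) ∧ 0 < minArcSup a ν W x) :
    ∃ z : Fin n → ℝ, (∀ i j, arcSup a ν W z i = arcSup a ν W z j) ∧
      ∀ x, (∀ j, x j ≤ next x j) → ∀ j, minArcSup a ν W x ≤ arcSup a ν W z j := by
  have hε : ∀ k : ℕ, (0 : ℝ) < 1 / ((k : ℝ) + 1) := fun k => by positivity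
  choose z hz hmax using fun k : ℕ => exists_minArcSup_maximizer
    (ha.continuous_tilt (1 / ((k : ℝ) + 1))) (ha.tilt_nonneg (1 / ((k : ℝ) + 1))) hν hW hWC
  set N := ∑ i, ν i with hN
  have hle : ∀ (k : ℕ) x, (∀ j, x j ≤ next x j) →
      minArcSup a ν W x ≤ minArcSup (tilt a (1 / ((k : ℝ) + 1))) ν W (z k) := fun k x hx =>
    le_trans (Finset.le_inf' _ _ fun j hj => (Finset.inf'_le _ hj).trans
      (ha.arcSup_le_tilt hν hW hWC (hε k).le x j)) (hmax k x hx)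
  have heq : ∀ (k : ℕ) j, arcSup (tilt a (1 / ((k : ℝ) + 1))) ν W (z k) j =
      minArcSup (tilt a (1 / ((k : ℝ) + 1))) ν W (z k) := by
    obtain ⟨x, hx, hx0⟩ := hpos
    exact fun k j => ha.arcSup_eq_of_maximizer hν hW hWC (hε k) (hz k).1 (hmax k)
      (hx0.trans_le (hle k x hx)) j
  obtain ⟨w, -, φ, hφ, hlim⟩ := isCompact_liftedSimplex.tendsto_subseq hz
  have hM : ∀ j, Tendsto (fun k => arcSup a ν W (z (φ k)) j) atTop (𝓝 (arcSup a ν W w j)) :=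
    fun j => ((continuous_arcSup ha.continuous ha.nonneg hν hW hWC j).tendsto w).comp hlim
  have hexp : Tendsto (fun k => Real.exp (1 / (((φ k : ℕ) : ℝ) + 1) * N)) atTop (𝓝 1) := by
    have h0 : Tendsto (fun k : ℕ => 1 / ((k : ℝ) + 1) * N) atTop (𝓝 0) := by
      simpa using (tendsto_one_div_add_atTop_nhds_zero_nat (𝕜 := ℝ)).mul_const N
    simpa [Function.comp_def] using
      (Real.continuous_exp.tendsto 0).comp (h0.comp hφ.tendsto_atTop)
  have hMe : ∀ j, Tendsto (fun k => arcSup a ν W (z (φ k)) j *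
      Real.exp (1 / (((φ k : ℕ) : ℝ) + 1) * N)) atTop (𝓝 (arcSup a ν W w j)) := fun j => by
    simpa using (hM j).mul hexp
  -- Along the subsequence the untilted `i`-th supremum is at most the tilted one, which equals the
  -- tilted `j`-th, which is at most the untilted `j`-th times a factor tending to `1`.
  have hord : ∀ i j, arcSup a ν W w i ≤ arcSup a ν W w j := fun i j =>
    le_of_tendsto_of_tendsto' (hM i) (hMe j) fun k =>
      (ha.arcSup_le_tilt hν hW hWC (hε (φ k)).le _ i).trans
        (((heq (φ k) i).trans (heq (φ k) j).symm).le.trans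
          (ha.arcSup_tilt_le hν hW hWC (hε (φ k)).le _ j))
  refine ⟨w, fun i j => le_antisymm (hord i j) (hord j i), fun x hx j => ?_⟩
  exact ge_of_tendsto' (hMe j) fun k => (hle (φ k) x hx).trans
    ((heq (φ k) j).symm.le.trans (ha.arcSup_tilt_le hν hW hWC (hε (φ k)).le _ j))

end

/-! ### From kernels and fields to their exponentials -/

lemma rep_mem (t : Torus) : rep t ∈ Ico (0 : ℝ) 1 := by
  simpa [rep] using (AddCircle.equivIco (1 : ℝ) 0 t).2

lemma coe_rep (t : Torus) : ((rep t : ℝ) : Torus) = t := AddCircle.coe_equivIco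

lemma rep_coe {s : ℝ} (hs : s ∈ Ico (0 : ℝ) 1) : rep s = s :=
  AddCircle.equivIco_coe_of_mem (by simpa using hs)

lemma coe_ne_zero {s : ℝ} (h0 : s ≠ 0) (h1 : |s| < 1) : (s : Torus) ≠ 0 := by
  rw [Ne, AddCircle.coe_eq_zero_iff]
  rintro ⟨m, rfl⟩
  simp only [zsmul_eq_mul, mul_one] at h0 h1
  have : |m| < 1 := by exact_mod_cast h1
  exact h0 (by rw [Int.abs_lt_one_iff.1 this]; simp)

/-- The exponential of a kernel, as a real function on the torus. -/
def expKernel (K : ℝ → ℝ) (t : Torus) : ℝ := (EReal.exp (kernelOnTorus K t)).toReal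

lemma expKernel_zero {K : ℝ → ℝ} (hsing : IsSingularKernel K) : expKernel K 0 = 0 := by
  rw [expKernel, kernelOnTorus, if_pos rfl, hsing, EReal.exp_bot, ENNReal.toReal_zero]

lemma expKernel_coe (K : ℝ → ℝ) {s : ℝ} (hs : s ∈ Ioo (0 : ℝ) 1) :
    expKernel K s = Real.exp (K s) := by
  rw [expKernel, kernelOnTorus, if_neg (coe_ne_zero hs.1.ne' (abs_lt.2 ⟨by linarith [hs.1], hs.2⟩)),
    rep_coe (Ioo_subset_Ico_self hs), EReal.exp_coe, ENNReal.toReal_ofReal (Real.exp_pos _).le]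

lemma tendsto_exp_of_tendsto_bot {l : Filter ℝ} {f : ℝ → ℝ}
    (h : Tendsto (fun t => (f t : EReal)) l (𝓝 ⊥)) : Tendsto (fun t => Real.exp (f t)) l (𝓝 0) := by
  have h1 := EReal.tendsto_exp_nhds_bot_nhds_zero.comp h
  have h2 := (ENNReal.tendsto_toReal ENNReal.zero_ne_top).comp h1
  refine h2.congr fun t => ?_
  simp [(Real.exp_pos _).le]

lemma IsKernelFunction.tendsto_bot {K : ℝ → ℝ} (hK : IsKernelFunction K)
    (hsing : IsSingularKernel K) :
    Tendsto (fun t : ℝ => (K t : EReal)) (𝓝[>] 0) (𝓝 ⊥) ∧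
    Tendsto (fun t : ℝ => (K t : EReal)) (𝓝[<] 0) (𝓝 ⊥) := by
  obtain ⟨l, h1, h2⟩ := hK.limit_zero
  have hl : l = ⊥ := h1.limUnder_eq.symm.trans hsing
  exact hl ▸ ⟨h1, h2⟩

lemma isExpKernel_expKernel {K : ℝ → ℝ} (hK : IsKernelFunction K) (hper : IsPeriodicKernel K)
    (hsing : IsSingularKernel K) : IsExpKernel (expKernel K) := by
  classical
  obtain ⟨hr, hl⟩ := hK.tendsto_bot hsing
  refine ⟨?_, expKernel_zero hsing, fun s hs => ?_, ?_⟩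
  · set f : ℝ → ℝ := fun s => if s ∈ Ioo (0 : ℝ) 1 then Real.exp (K s) else 0 with hf
    have hlift : expKernel K = AddCircle.liftIco 1 0 f := by
      ext t
      obtain ⟨s, hs, rfl⟩ := exists_coe_eq t
      rw [AddCircle.liftIco_zero_coe_apply hs]
      by_cases h : s ∈ Ioo (0 : ℝ) 1
      · rw [expKernel_coe K h, hf]
        exact (if_pos h).symm
      · have h0 : s = 0 := by
          by_contra h0
          exact h ⟨lt_of_le_of_ne hs.1 (Ne.symm h0), hs.2⟩
        subst h0
        simpa [hf] using expKernel_zero hsing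
    rw [hlift]
    refine AddCircle.liftIco_continuous (by simp [hf]) fun s hs => ?_
    have hs : s ∈ Icc (0 : ℝ) 1 := by simpa using hs
    refine ContinuousAt.continuousWithinAt ?_
    have hf0 : ∀ t, t ∉ Ioo (0 : ℝ) 1 → f t = 0 := fun t ht => if_neg ht
    have hf1 : ∀ t ∈ Ioo (0 : ℝ) 1, f t = Real.exp (K t) := fun t ht => if_pos ht
    rcases hs.1.eq_or_lt with h0 | h0
    · subst h0
      rw [continuousAt_iff_continuous_left'_right']
      constructor
      · refine (tendsto_const_nhds (x := (0 : ℝ))).congr' ?_ |>.trans (by rw [hf0 0 (by simp)])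
        filter_upwards [self_mem_nhdsWithin] with t ht
        exact (hf0 t fun h => lt_asymm h.1 ht).symm
      · refine (tendsto_exp_of_tendsto_bot hr).congr' ?_ |>.trans (by rw [hf0 0 (by simp)])
        filter_upwards [Ioo_mem_nhdsGT (zero_lt_one' ℝ)] with t ht
        exact (hf1 t ht).symm
    rcases hs.2.eq_or_lt with h1 | h1
    · subst h1
      rw [continuousAt_iff_continuous_left'_right']
      constructor
      -- Periodicity turns the left limit of `K` at `1` into its left limit at `0`.
      · have hshift : Tendsto (fun t : ℝ => t - 1) (𝓝[<] 1) (𝓝[<] 0) := by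
          refine tendsto_nhdsWithin_iff.2 ⟨?_, ?_⟩
          · refine Tendsto.mono_left ?_ nhdsWithin_le_nhds
            have : Continuous fun t : ℝ => t - 1 := by fun_prop
            simpa using this.tendsto 1
          · filter_upwards [self_mem_nhdsWithin] with t ht
            exact sub_neg.2 (mem_Iio.1 ht)
        refine ((tendsto_exp_of_tendsto_bot hl).comp hshift).congr' ?_ |>.trans
          (by rw [hf0 1 (by simp)])
        filter_upwards [Ioo_mem_nhdsLT (zero_lt_one' ℝ)] with t ht
        rw [hf1 t ht, Function.comp_apply, hper t ht]
      · refine (tendsto_const_nhds (x := (0 : ℝ))).congr' ?_ |>.trans (by rw [hf0 1 (by simp)])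
        filter_upwards [self_mem_nhdsWithin] with t ht
        exact (hf0 t fun h => lt_asymm h.2 ht).symm
    · have hc := (hK.concaveOn_right.continuousOn isOpen_Ioo).continuousAt (Ioo_mem_nhds h0 h1)
      refine (Real.continuous_exp.continuousAt.comp hc).congr ?_
      filter_upwards [Ioo_mem_nhds h0 h1] with t ht
      exact (hf1 t ht).symm
  · rw [expKernel_coe K hs]
    exact Real.exp_pos _
  · refine hK.concaveOn_right.congr fun s hs => ?_
    simp only [expKernel_coe K hs, Real.log_exp]

/-- The exponential of a field, as a real function on the torus. -/
def expField (J : Torus → EReal) (t : Torus) : ℝ := (EReal.exp (J t)).toReal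

lemma exp_sum_ereal {ι : Type*} (s : Finset ι) (f : ι → EReal) :
    EReal.exp (∑ i ∈ s, f i) = ∏ i ∈ s, EReal.exp (f i) := by
  classical
  induction s using Finset.induction_on with
  | empty => simp
  | insert i s hi ih => rw [Finset.sum_insert hi, Finset.prod_insert hi, EReal.exp_add, ih]

lemma kernelOnTorus_ne_top {K : ℝ → ℝ} (hsing : IsSingularKernel K) (t : Torus) :
    kernelOnTorus K t ≠ ⊤ := by
  unfold kernelOnTorus
  split_ifs
  · rw [hsing]
    exact bot_ne_top
  · exact EReal.coe_ne_top _

/-- The passage from extended-real sums to real products: the value `-∞` becomes a factor `0`, and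
no term is `⊤`, so `toReal` loses nothing. -/
lemma exp_sumOfTranslates {ν : Fin n → ℝ} (hν : ∀ j, 0 < ν j) {K : ℝ → ℝ}
    (hsing : IsSingularKernel K) {J : Torus → EReal} (hJ : ∀ t, J t ≠ ⊤) (x : Fin n → ℝ) (s : ℝ) :
    EReal.exp (sumOfTranslates ν K J (fun i => (x i : Torus)) s) =
      ENNReal.ofReal (expField J s * translateProd (expKernel K) ν x s) := by
  have hk : ∀ t, 0 ≤ expKernel K t := fun t => ENNReal.toReal_nonneg
  have h1 : ∀ e : EReal, e ≠ ⊤ → ENNReal.ofReal (EReal.exp e).toReal = EReal.exp e := fun e he =>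
    ENNReal.ofReal_toReal (by simpa using he)
  rw [sumOfTranslates, EReal.exp_add, exp_sum_ereal, expField, ENNReal.ofReal_mul ENNReal.toReal_nonneg,
    h1 _ (hJ _), translateProd,
    ENNReal.ofReal_prod_of_nonneg fun i _ => Real.rpow_nonneg (hk _) _]
  congr 1
  refine Finset.prod_congr rfl fun i _ => ?_
  rw [mul_comm, EReal.exp_mul, ← ENNReal.ofReal_rpow_of_nonneg (hk _) (hν i).le,
    expKernel, h1 _ (kernelOnTorus_ne_top hsing _), AddCircle.coe_sub]

/-! ### Arcs of the torus and their lifts -/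

section

variable [NeZero n]

/-- When all gaps are positive, the exceptional whole-torus arc occurs only for `n = 1`, exactly
when the lifted arc has length `1`; otherwise the length is below `1` and `rep` recovers it. -/
lemma nodeArc_coe {x : Fin n → ℝ} (h : ∀ j, x j < next x j) (j : Fin n) :
    nodeArc (fun i => (x i : Torus)) j = (fun s : ℝ => (s : Torus)) '' Icc (x j) (next x j) := by
  have hj := next_le_add_one (fun j => (h j).le) j j
  have hlift : ∀ t : Torus, ((x j + rep (t - x j) : ℝ) : Torus) = t := fun t => by
    rw [AddCircle.coe_add, coe_rep, add_sub_cancel]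
  unfold nodeArc
  split_ifs with hc
  · have hnext : next x j = x j + 1 := by
      by_contra hne
      have hlt : next x j < x j + 1 := lt_of_le_of_ne hj hne
      have h0 : ((next x j - x j : ℝ) : Torus) ≠ 0 :=
        coe_ne_zero (sub_pos.2 (h j)).ne' (abs_lt.2 ⟨by linarith [h j], by linarith⟩)
      exact h0 (by rw [AddCircle.coe_sub, coe_next, sub_eq_zero]; exact hc.2 (j + 1))
    refine (eq_univ_of_forall fun t => ?_).symm
    have := rep_mem (t - x j)
    exact ⟨_, ⟨by linarith [this.1], by linarith [this.2]⟩, hlift t⟩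
  · have hlt : next x j < x j + 1 := by
      refine lt_of_le_of_ne hj fun heq => hc ?_
      unfold next at heq
      obtain ⟨hm, h1⟩ := strictMono_of_lt_next h
      split_ifs at heq with hn
      · refine ⟨hn, fun i => ?_⟩
        have hj1 : j = 0 := by
          rw [← add_one_eq_zero hn]
          exact (hm.injective (by linarith)).symm
        have : n = 1 := by rw [← hn, hj1]; simp
        subst this
        rw [Subsingleton.elim i j]
      · exact absurd (h1 j (j + 1)) (by linarith)
    have hrep : rep ((x (j + 1) : Torus) - x j) = next x j - x j := by
      rw [← coe_next, ← AddCircle.coe_sub]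
      exact rep_coe ⟨by linarith [h j], by linarith⟩
    ext t
    simp only [arc, mem_ofPred_eq, hrep]
    constructor
    · intro ht
      exact ⟨_, ⟨by linarith [(rep_mem (t - x j)).1], by linarith⟩, hlift t⟩
    · rintro ⟨s, hs, rfl⟩
      rw [← AddCircle.coe_sub, rep_coe ⟨by linarith [hs.1], by linarith [hs.2]⟩]
      linarith [hs.2]

variable {ν : Fin n → ℝ} {K : ℝ → ℝ} {J : Torus → EReal} {C : ℝ}

lemma arcMax_coe (ha : IsExpKernel (expKernel K)) (hν : ∀ j, 0 < ν j)
    (hsing : IsSingularKernel K) (hJ : ∀ t, J t ≠ ⊤) (hC : ∀ t, expField J t ≤ C)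
    {x : Fin n → ℝ} (h : ∀ j, x j < next x j) (j : Fin n) :
    arcMax ν K J (fun i => (x i : Torus)) j =
      ENNReal.log (ENNReal.ofReal (arcSup (expKernel K) ν (expField J) x j)) := by
  have hW : ∀ t, 0 ≤ expField J t := fun t => ENNReal.toReal_nonneg
  rw [arcMax, nodeArc_coe h, iSup_image]
  apply le_antisymm
  · refine iSup₂_le fun s hs => ?_
    rw [← EReal.exp_le_exp_iff, ENNReal.exp_log, exp_sumOfTranslates hν hsing hJ]
    exact ENNReal.ofReal_le_ofReal (le_arcSup ha.continuous ha.nonneg hν hW hC hs)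
  · rw [← EReal.exp_le_exp_iff, ENNReal.exp_log]
    set B := ⨆ s ∈ Icc (x j) (next x j), sumOfTranslates ν K J (fun i => (x i : Torus)) s with hB
    -- The value `⊤` is treated apart because `toReal` would send it to `0`.
    by_cases htop : EReal.exp B = ⊤
    · rw [htop]
      exact le_top
    rw [ENNReal.ofReal_le_iff_le_toReal htop]
    refine arcSup_le ha.zero hν ENNReal.toReal_nonneg fun s hs => ?_
    rw [← ENNReal.ofReal_le_iff_le_toReal htop, ← exp_sumOfTranslates hν hsing hJ,
      EReal.exp_le_exp_iff]
    exact le_iSup₂ (f := fun s _ => sumOfTranslates ν K J (fun i => (x i : Torus)) (s : ℝ)) s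
      (Ioo_subset_Icc_self hs)

lemma arc_self (a : Torus) : arc a a = {a} := by
  have h0 : rep 0 = 0 := rep_coe (s := 0) (by simp)
  ext t
  simp only [arc, mem_ofPred_eq, sub_self, h0, mem_singleton_iff]
  constructor
  · intro h
    have h1 : rep (t - a) = 0 := le_antisymm h (rep_mem _).1
    have h2 := coe_rep (t - a)
    rw [h1] at h2
    exact sub_eq_zero.1 h2.symm
  · rintro rfl
    rw [sub_self, h0]

/-- Some arc is a single node, where the singular kernel forces the value `-∞`. Boundary points of
the closed simplex therefore never compete for the maximin. -/
lemma minArcMax_eq_bot (hν : ∀ j, 0 < ν j) (ha0 : expKernel K 0 = 0)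
    (hsing : IsSingularKernel K) (hJ : ∀ t, J t ≠ ⊤) {x : Fin n → ℝ} {j : Fin n}
    (h : x j = next x j) : minArcMax ν K J (fun i => (x i : Torus)) = ⊥ := by
  have hn : n ≠ 1 := by
    rintro rfl
    rw [next, if_pos (by omega), Subsingleton.elim (j + 1) j] at h
    linarith
  have key : ∃ i, nodeArc (fun i => (x i : Torus)) i = {(x i : Torus)} := by
    -- If all nodes coincide and `j` is last, its arc is the whole torus; arc `0` is degenerate
    -- instead, and is not the last one since `n ≠ 1`.
    by_cases hc : (j : ℕ) + 1 = n ∧ ∀ i, (x i : Torus) = x j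
    · refine ⟨0, ?_⟩
      rw [nodeArc, if_neg fun h0 => hn (by simpa using h0.1.symm), hc.2 0, hc.2 (0 + 1), arc_self]
    · refine ⟨j, ?_⟩
      rw [nodeArc, if_neg hc, ← coe_next, ← h, arc_self]
  obtain ⟨i, hi⟩ := key
  refine le_bot_iff.1 ((iInf_le _ i).trans ?_)
  rw [arcMax, hi, iSup_singleton, le_bot_iff, ← EReal.exp_eq_zero_iff,
    exp_sumOfTranslates hν hsing hJ, translateProd_eq_zero ha0 (hν i) rfl, mul_zero,
    ENNReal.ofReal_zero]

/-- Choose `n + 1` points of finiteness in `[0, 1)` in increasing order and put the nodes at the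
midpoints of consecutive ones. The `j`-th arc then contains the point `τ j.succ` in its interior,
and this point is not a node modulo `1`. -/
lemma IsFieldFunction.exists_minArcSup_pos {a : Torus → ℝ} (hJ : IsFieldFunction n J)
    (ha : IsExpKernel a) (hν : ∀ j, 0 < ν j) (hJtop : ∀ t, J t ≠ ⊤) (hC : ∀ t, expField J t ≤ C) :
    ∃ x : Fin n → ℝ, (∀ j, x j ≤ next x j) ∧ 0 < minArcSup a ν (expField J) x := by
  have hcard : ((n + 1 : ℕ) : ℕ∞) ≤ (rep '' {t | J t ≠ ⊥}).encard := by
    have hinj : Function.Injective rep := fun s t hst => by rw [← coe_rep s, hst, coe_rep]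
    rw [hinj.encard_image]
    push_cast
    exact Order.add_one_le_of_lt hJ.finite_points
  obtain ⟨T, hTS, hT⟩ := exists_subset_encard_eq hcard
  have hfin : T.Finite := finite_of_encard_eq_coe hT
  have hTc : hfin.toFinset.card = n + 1 := by
    rw [hfin.encard_eq_coe_toFinset_card] at hT
    exact_mod_cast hT
  set τ := hfin.toFinset.orderEmbOfFin hTc with hτdef
  have hτ : ∀ i, τ i ∈ Ico (0 : ℝ) 1 ∧ J (τ i : ℝ) ≠ ⊥ := by
    intro i
    have hi : τ i ∈ T := hfin.mem_toFinset.1 (Finset.orderEmbOfFin_mem _ hTc i)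
    obtain ⟨t, ht, hti⟩ := hTS hi
    rw [← hti, coe_rep]
    exact ⟨rep_mem t, ht⟩
  have hstep : ∀ j : Fin n, τ j.castSucc < τ j.succ := fun j =>
    τ.strictMono Fin.castSucc_lt_succ
  set x : Fin n → ℝ := fun j => (τ j.castSucc + τ j.succ) / 2 with hx
  have hx1 : ∀ j, τ j.castSucc < x j := fun j => by
    have := hstep j
    simp only [hx]
    linarith
  have hx2 : ∀ j, x j < τ j.succ := fun j => by
    have := hstep j
    simp only [hx]
    linarith
  have hx3 : ∀ j, τ j.succ < next x j := by
    intro j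
    unfold next
    split_ifs with hj
    -- The last arc ends at a node shifted by `1`, which lies beyond `1` and hence beyond all the
    -- chosen points.
    · linarith [(hτ j.succ).1.2, hx1 (j + 1), (hτ (j + 1).castSucc).1.1]
    · have : (j + 1).castSucc = j.succ := by
        ext
        rw [Fin.val_castSucc, Fin.val_add_one_of_lt' (by omega), Fin.val_succ]
      rw [add_zero, ← this]
      exact hx1 _
  have hW : ∀ t, 0 ≤ expField J t := fun t => ENNReal.toReal_nonneg
  refine ⟨x, fun j => ((hx2 j).trans (hx3 j)).le, (Finset.lt_inf'_iff _).2 fun j _ => ?_⟩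
  refine lt_of_lt_of_le (mul_pos ?_ ?_)
    (le_arcSup ha.continuous ha.nonneg hν hW hC ⟨(hx2 j).le, (hx3 j).le⟩)
  · exact ENNReal.toReal_pos (by simpa using (hτ j.succ).2) (by simpa using hJtop _)
  · refine Finset.prod_pos fun i _ => Real.rpow_pos_of_pos (ha.pos_of_ne_zero ?_) _
    have h1 := (hτ j.succ).1
    have h2 := (hτ i.succ).1
    have h3 := (hτ i.castSucc).1
    refine coe_ne_zero (sub_ne_zero.2 ?_) (abs_lt.2
      ⟨by linarith [hx2 i, h1.1, h2.2], by linarith [hx1 i, h1.2, h3.1]⟩)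
    rcases le_or_gt i j with hij | hij
    · exact ((hx2 i).trans_le (τ.monotone (Fin.succ_le_succ_iff.2 hij))).ne'
    · exact ((τ.monotone (Fin.succ_le_castSucc_iff.2 hij)).trans_lt (hx1 i)).ne

end

end SumOfTranslates
end

/-! ### The main theorem -/

open SumOfTranslates

theorem mainTheorem5 (n : ℕ) [NeZero n] (ν : Fin n → ℝ) (hν : ∀ j, 0 < ν j)
    (K : ℝ → ℝ) (hK : SumOfTranslates.IsKernelFunction K)
    (hper : SumOfTranslates.IsPeriodicKernel K) (hsing : SumOfTranslates.IsSingularKernel K)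
    (J : SumOfTranslates.Torus → EReal) (hJ : SumOfTranslates.IsFieldFunction n J) :
    ∃ z : Fin n → SumOfTranslates.Torus,
      SumOfTranslates.IsMaximinPoint ν K J z ∧
      z ∈ SumOfTranslates.cyclicSimplex n ∧
      SumOfTranslates.IsEquioscillationPoint ν K J z := by
  have ha := isExpKernel_expKernel hK hper hsing
  obtain ⟨c, hc⟩ := hJ.bddAbove
  have hJtop : ∀ t, J t ≠ ⊤ := fun t => ((hc t).trans_lt (EReal.coe_lt_top c)).ne
  have hC : ∀ t, expField J t ≤ Real.exp c := fun t => by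
    refine ENNReal.toReal_le_of_le_ofReal (Real.exp_pos c).le ?_
    rw [← EReal.exp_coe]
    exact EReal.exp_monotone (hc t)
  have hpos := hJ.exists_minArcSup_pos ha hν hJtop hC
  have hW : ∀ t, 0 ≤ expField J t := fun t => ENNReal.toReal_nonneg
  obtain ⟨z, heq, hmax⟩ := ha.exists_equioscillating_maximizer hν hW hC hpos
  have hz : ∀ j, z j < next z j := by
    obtain ⟨x, hx, hx0⟩ := hpos
    exact fun j => lt_next_of_arcSup_pos ha.zero hν (hx0.trans_le (hmax x hx j))
  have harc := fun j => arcMax_coe ha hν hsing hJtop hC hz j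
  obtain ⟨hmono, hlt⟩ := strictMono_of_lt_next hz
  have hmem : (fun i => (z i : Torus)) ∈ closedCyclicSimplex n :=
    ⟨z, fun _ => rfl, hmono.monotone, fun i j => (hlt i j).le⟩
  refine ⟨fun i => (z i : Torus), ⟨hmem, le_antisymm ?_ ?_⟩, ⟨z, fun _ => rfl, hmono, hlt⟩,
    fun i j => by rw [harc, harc, heq i j]⟩
  · exact le_iSup₂ (f := fun y _ => minArcMax ν K J y) _ hmem
  refine iSup₂_le fun y hy => ?_
  obtain ⟨x, hxy, hxm, hx1⟩ := hy
  obtain rfl : (fun i => (x i : Torus)) = y := funext hxy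
  have hx := le_next_of_monotone hxm hx1
  -- Competitors with distinct nodes are compared through `arcSup`; the degenerate ones have minimum
  -- `⊥`.
  by_cases hstrict : ∀ j, x j < next x j
  · obtain ⟨i, -, hi⟩ := Finset.exists_mem_eq_inf' Finset.univ_nonempty
      (arcSup (expKernel K) ν (expField J) x)
    refine le_iInf fun j => (iInf_le _ i).trans ?_
    rw [harc, arcMax_coe ha hν hsing hJtop hC hstrict]
    exact ENNReal.log_monotone (ENNReal.ofReal_le_ofReal (hi.symm.le.trans (hmax x hx j)))
  · push Not at hstrict
    obtain ⟨j, hj⟩ := hstrict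
    rw [minArcMax_eq_bot hν ha.zero hsing hJtop (le_antisymm (hx j) hj)]
    exact bot_le
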